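/- Let $n\ge 0$, let $\mathfrak{gl}_n=\mathfrak{gl}_n(\mathbb C)$ with its basis of matrix units $E_{ij}$ and the commutator bracket $[E_{ij},E_{kl}]=\delta_{kj}E_{il}-\delta_{il}E_{kj}$, and let $\mathrm U(\mathfrak{gl}_n)$ be its universal enveloping algebra. Let $E$ be the $n\times n$ matrix over $\mathrm U(\mathfrak{gl}_n)$ whose $(i,j)$ entry is $E_{ij}$, and let $E^t$ be its transpose, $(E^t)_{ij}=E_{ji}$. The Capelli determinant is the polynomial in $u$ with coefficients in $\mathrm U(\mathfrak{gl}_n)$ $$C(u)=\sum_{p\in\mathfrak S_n}\operatorname{sgn}p\cdot (u+E)_{p(1),1}\,(u+E-1)_{p(2),2}\cdots(u+E-n+1)_{p(n),n}.$$ For a matrix $A$ over $\mathrm U(\mathfrak{gl}_n)$ and $C(u)=\sum_k C_k u^k$, put $C(A)=\sum_k C_k A^k$, where $C_k$ stands for the scalar matrix with diagonal entries $C_k$. A scalar that is added to a matrix stands for the corresponding multiple of the identity matrix. **Theorem.** The coefficients of $C(u)$ belong to the center of $\mathrm U(\mathfrak{gl}_n)$, and $$C(-E+n-1)=0\qquad\text{and}\qquad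 C(-E^{t})=0.$$ Consequently, let $L$ be a highest weight representation of $\mathfrak{gl}_n$ with highest weight $(\lambda_1,\dots,\lambda_n)\in\mathbb C^n$; that is, $L$ is generated by a nonzero vector $v$ with $E_{ij}v=0$ for $i<j$ and $E_{ii}v=\lambda_i v$ for all $i$. Put $l_i=\lambda_i-i+1$ for $1\le i\le n$. Then the image of the matrix $E$ in $L$, a matrix with entries in $\operatorname{End}L$, satisfies $$\prod_{i=1}^n(E-l_i-n+1)=0\qquad\text{and}\qquad\prod_{i=1}^n(E^{t}-l_i)=0 .$$ -/

import Mathlib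

open Polynomial Matrix

attribute [local instance 100] LieRing.ofAssociativeRing

noncomputable section

namespace CapelliCH

/-- The general linear Lie algebra of complex `n × n` matrices, with the commutator bracket. -/
abbrev gl (n : ℕ) : Type := Matrix (Fin n) (Fin n) ℂ

/-- The universal enveloping algebra of `gl n`. -/
abbrev U (n : ℕ) : Type := UniversalEnvelopingAlgebra ℂ (gl n)

/-- The generator matrix `E`: its `(i, j)` entry is the matrix unit `E_ij`, seen in `U n`. -/
def genMatrix (n : ℕ) : Matrix (Fin n) (Fin n) (U n) :=
  Matrix.of fun i j => UniversalEnvelopingAlgebra.ι ℂ (Matrix.single i j (1 : ℂ) : gl n)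

/-- The matrix `u + E - k` over `U n [u]`, where `u` is the (central) polynomial variable. -/
def shiftedMatrix (n k : ℕ) : Matrix (Fin n) (Fin n) (U n)[X] :=
  Matrix.scalar (Fin n) X + (genMatrix n).map C - (k : Matrix (Fin n) (Fin n) (U n)[X])

/-- The Capelli determinant
`C(u) = ∑ p, sgn p * (u + E)_{p(1),1} * (u + E - 1)_{p(2),2} * ⋯ * (u + E - n + 1)_{p(n),n}`,
the noncommutative product being taken from left to right.
Indices run through `0, …, n - 1`, so that the factor in column `k` is taken from `u + E - k`. -/
def capelliDet (n : ℕ) : (U n)[X] :=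
  ∑ p : Equiv.Perm (Fin n), ((Equiv.Perm.sign p : ℤ) : (U n)[X]) *
    (List.ofFn fun k : Fin n => shiftedMatrix n k (p k) k).prod

/-- The value `P(A) = ∑ k, P_k A ^ k` of a polynomial `P` with coefficients `P_k` in `U n` at a
matrix `A` over `U n`; a coefficient is identified with the corresponding scalar matrix. -/
def evalMatrix {n : ℕ} (P : (U n)[X]) (A : Matrix (Fin n) (Fin n) (U n)) :
    Matrix (Fin n) (Fin n) (U n) :=
  P.eval₂ (Matrix.scalar (Fin n)) A

section Rep

variable {n : ℕ} (V : Type*) [AddCommGroup V] [Module ℂ V] [LieRingModule (gl n) V]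
  [LieModule ℂ (gl n) V]

/-- The image of the generator matrix in a representation `V`, a matrix over `End V`:
each entry is sent through the action `U n → End V` of the enveloping algebra. -/
def genMatrixOn : Matrix (Fin n) (Fin n) (Module.End ℂ V) :=
  (genMatrix n).map (UniversalEnvelopingAlgebra.lift ℂ (LieModule.toEnd ℂ (gl n) V))

/-- `V` is a highest weight representation with highest weight `lam`: it is generated by a nonzero
vector `v` such that `E_ij v = 0` for `i < j` and `E_ii v = lam i • v`. -/
def IsHighestWeightRep (lam : Fin n → ℂ) : Prop :=
  ∃ v : V, v ≠ 0 ∧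
    (∀ i j : Fin n, i < j → ⁅(Matrix.single i j (1 : ℂ) : gl n), v⁆ = 0) ∧
    (∀ i : Fin n, ⁅(Matrix.single i i (1 : ℂ) : gl n), v⁆ = lam i • v) ∧
    LieSubmodule.lieSpan ℂ (gl n) {v} = ⊤

end Rep

/-- `l_i = λ_i - i + 1` for `i = 1, …, n`; the index `i : Fin n` stands for `i + 1`. -/
def shiftedWeight {n : ℕ} (lam : Fin n → ℂ) (i : Fin n) : ℂ :=
  lam i - ((i : ℕ) + 1 : ℂ) + 1

end CapelliCH

end

/-!
The commutation relations of the matrix units say that `u + E - k` and `u + E - k - 1` satisfy an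
exchange relation for their columns. Hence `C(u)`, viewed as a column determinant whose factors come
from `u + E, u + E - 1, …, u + E - n + 1`, is alternating in the choice of columns, and Cramer's
rule survives for the two extreme factors: expanding along the first or the last column gives
`(u + E)ᵗ N = C(u)` and `N' (u + E - n + 1) = C(u)`. The factor theorem for polynomials with matrix
coefficients turns these into the two characteristic identities. It requires the coefficients of
`C(u)` to commute with the generators in the first case; this holds because the derivation
`[E_ab, ·]` replaces row `b` by row `a` and column `a` by column `b` with opposite signs, and the
two resulting determinants vanish if `a ≠ b` and cancel if `a = b`.

Modulo the left ideal annihilating a highest weight vector, the columns are triangular, so `C(u)`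
acts on that vector as `∏ i, (u + l_i)`; being central, it acts so on the whole module.
-/

noncomputable section

namespace CapelliCH

open Equiv

section PolynomialMatrices

variable {R ι : Type*} [Ring R] [Fintype ι] [DecidableEq ι]

/-- A polynomial with matrix coefficients as a matrix of polynomials. Mathlib's `matPolyEquiv`
requires the entries to commute. -/
def polynomialToMatrix : (Matrix ι ι R)[X] →+* Matrix ι ι R[X] :=
  eval₂RingHom' (C : R →+* R[X]).mapMatrix (scalar ι X) fun _ =>
    (scalar_commute X commute_X _).symm

theorem coeff_polynomialToMatrix_apply (P : (Matrix ι ι R)[X]) (i j : ι) (k : ℕ) :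
    (polynomialToMatrix P i j).coeff k = P.coeff k i j := by
  induction P using Polynomial.induction_on' with
  | add p q hp hq => simp only [map_add, Matrix.add_apply, coeff_add, hp, hq]
  | monomial m A =>
    have h : polynomialToMatrix (monomial m A) i j = monomial m (A i j) := by
      simp [polynomialToMatrix, diagonal_pow, mul_diagonal, C_mul_X_pow_eq_monomial]
    rw [h, coeff_monomial, coeff_monomial]
    split_ifs <;> rfl

theorem polynomialToMatrix_injective :
    Function.Injective (polynomialToMatrix : (Matrix ι ι R)[X] →+* Matrix ι ι R[X]) := by
  intro P Q h
  ext k i j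
  rw [← coeff_polynomialToMatrix_apply, h, coeff_polynomialToMatrix_apply]

theorem polynomialToMatrix_surjective :
    Function.Surjective (polynomialToMatrix : (Matrix ι ι R)[X] →+* Matrix ι ι R[X]) := by
  rw [← RingHom.range_eq_top, eq_top_iff]
  intro N _
  rw [matrix_eq_sum_single N]
  refine sum_mem fun i _ => sum_mem fun j _ => ?_
  induction N i j using Polynomial.induction_on' with
  | add p q hp hq => simpa only [single_add] using add_mem hp hq
  | monomial m a =>
    refine ⟨monomial m (single i j a), ?_⟩
    ext i' j' k
    rw [coeff_polynomialToMatrix_apply, coeff_monomial, single_apply, apply_ite (coeff · k),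
      coeff_monomial, coeff_zero]
    split_ifs <;> simp_all

theorem polynomialToMatrix_X_sub_C (A : Matrix ι ι R) :
    polynomialToMatrix (X - C A) = scalar ι X - A.map C := by
  simp [polynomialToMatrix]

theorem polynomialToMatrix_map_scalar (P : R[X]) :
    polynomialToMatrix (P.map (scalar ι)) = scalar ι P := by
  ext i j k
  rw [coeff_polynomialToMatrix_apply, coeff_map, scalar_apply, scalar_apply, diagonal_apply,
    diagonal_apply, apply_ite (coeff · k), coeff_zero]

theorem eval₂_scalar_eq_zero_of_mul_eq {A : Matrix ι ι R} {N : Matrix ι ι R[X]} {P : R[X]}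
    (h : N * (scalar ι X - A.map C) = scalar ι P) : P.eval₂ (scalar ι) A = 0 := by
  obtain ⟨N, rfl⟩ := polynomialToMatrix_surjective N
  rw [← polynomialToMatrix_X_sub_C, ← polynomialToMatrix_map_scalar, ← map_mul] at h
  rw [← eval_map, ← polynomialToMatrix_injective h, eval_mul_X_sub_C]

theorem eval₂_scalar_eq_zero_of_eq_mul {A : Matrix ι ι R} {N : Matrix ι ι R[X]} {P : R[X]}
    (hP : ∀ k i j, Commute (P.coeff k) (A i j))
    (h : (scalar ι X - A.map C) * N = scalar ι P) : P.eval₂ (scalar ι) A = 0 := by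
  refine eval₂_scalar_eq_zero_of_mul_eq (N := N) ?_
  obtain ⟨N, rfl⟩ := polynomialToMatrix_surjective N
  have hcomm : Commute (P.map (scalar ι)) (X - C A) := by
    refine (commute_X _).symm.sub_right ?_
    ext k i j
    simp [(hP k i j).eq]
  rw [← polynomialToMatrix_X_sub_C, ← polynomialToMatrix_map_scalar, ← map_mul] at h ⊢
  congr 1
  apply (monic_X_sub_C A).isRegular.left
  change (X - C A) * (N * (X - C A)) = (X - C A) * P.map (scalar ι)
  rw [← mul_assoc, polynomialToMatrix_injective h, hcomm.eq]

end PolynomialMatrices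

section ListProducts

theorem exists_prod_ofFn_eq_mul_mul {M : Type*} [Monoid M] {n : ℕ} {k l : Fin n} (hkl : k ⋖ l)
    (g : Fin n → M) :
    ∃ L R : M, ∀ f : Fin n → M, (∀ m, m ≠ k → m ≠ l → f m = g m) →
      (List.ofFn f).prod = L * (f k * f l) * R := by
  have hl : (l : ℕ) = k + 1 := (Nat.covBy_iff_add_one_eq.mp (Fin.covBy_iff.mp hkl)).symm
  refine ⟨((List.ofFn g).take k).prod, ((List.ofFn g).drop (k + 2)).prod, fun f hf => ?_⟩
  have htake : (List.ofFn f).take k = (List.ofFn g).take k :=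
    List.ext_getElem (by simp) fun m hm _ => by
      have : m < k := by simp only [List.length_take] at hm; lia
      simp only [List.getElem_take, List.getElem_ofFn]
      exact hf _ (Fin.ne_of_val_ne (by simp only; lia)) (Fin.ne_of_val_ne (by simp only; lia))
  have hdrop : (List.ofFn f).drop (k + 2) = (List.ofFn g).drop (k + 2) :=
    List.ext_getElem (by simp) fun m _ _ => by
      simp only [List.getElem_drop, List.getElem_ofFn]
      exact hf _ (Fin.ne_of_val_ne (by simp only; lia)) (Fin.ne_of_val_ne (by simp only; lia))
  have hpair : (List.ofFn f).drop k = f k :: f l :: (List.ofFn f).drop (k + 2) := by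
    rw [List.drop_eq_getElem_cons (by simp), List.drop_eq_getElem_cons (by simp; lia),
      List.getElem_ofFn, List.getElem_ofFn]
    simp only [← hl, Fin.eta]
    rw [hl]
  rw [← List.prod_take_mul_prod_drop (List.ofFn f) k, hpair, htake, hdrop, List.prod_cons,
    List.prod_cons]
  simp only [mul_assoc]

theorem lie_prod_ofFn {A : Type*} [Ring A] (e : A) {n : ℕ} (f : Fin n → A) :
    ⁅e, (List.ofFn f).prod⁆ = ∑ k, (List.ofFn (Function.update f k ⁅e, f k⁆)).prod := by
  induction n with
  | zero => simp [Ring.lie_def]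
  | succ n ih =>
    induction f using Fin.consCases with | _ a f
    have h := ih f
    simp only [Ring.lie_def] at h ⊢
    simp only [Fin.sum_univ_succ, Fin.update_cons_zero, ← Fin.cons_update, List.ofFn_cons,
      List.prod_cons, Fin.cons_zero, Fin.cons_succ, ← Finset.mul_sum, ← h]
    noncomm_ring

end ListProducts

section ColumnDeterminant

variable {A ι : Type*} {n : ℕ}

/-- The matrix whose `k`-th column is the `c k`-th column of `S k`. -/
def selectCols (S : Fin n → Matrix (Fin n) ι A) (c : Fin n → ι) : Matrix (Fin n) (Fin n) A :=
  of fun i k => S k i (c k)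

theorem selectCols_update (S : Fin n → Matrix (Fin n) ι A) (c : Fin n → ι) (k : Fin n) (j : ι) :
    selectCols S (Function.update c k j) = (selectCols S c).updateCol k fun i => S k i j := by
  ext i m
  rcases eq_or_ne m k with rfl | hm <;> simp [selectCols, *]

theorem updateCol_perm_apply (M : Matrix (Fin n) (Fin n) A) (σ : Perm (Fin n)) (k : Fin n)
    (x : Fin n → A) :
    (fun m => M.updateCol k x (σ m) m) = Function.update (fun m => M (σ m) m) k (x (σ k)) := by
  funext m
  rcases eq_or_ne m k with rfl | hm <;> simp [*]

variable [Ring A]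

/-- The column determinant of a square matrix over a noncommutative ring: the factors of each
product are ordered by their columns. -/
def columnDet (M : Matrix (Fin n) (Fin n) A) : A :=
  ∑ σ : Perm (Fin n), Perm.sign σ • (List.ofFn fun k => M (σ k) k).prod

theorem columnDet_updateCol_sub (M : Matrix (Fin n) (Fin n) A) (k : Fin n) (x y : Fin n → A) :
    columnDet (M.updateCol k (x - y)) =
      columnDet (M.updateCol k x) - columnDet (M.updateCol k y) := by
  have h := (MultilinearMap.mkPiAlgebraFin ℤ n A).map_update_sub
  simp only [MultilinearMap.mkPiAlgebraFin_apply] at h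
  simp only [columnDet, updateCol_perm_apply, Pi.sub_apply, h, smul_sub, Finset.sum_sub_distrib]

theorem columnDet_eq_zero_of_row_eq {M : Matrix (Fin n) (Fin n) A} {i j : Fin n} (hij : i ≠ j)
    (h : M i = M j) : columnDet M = 0 := by
  refine Finset.sum_involution (fun σ _ => swap i j * σ) (fun σ _ => ?_)
    (fun σ _ _ => swap_mul_eq_iff.not.mpr hij) (fun _ _ => Finset.mem_univ _)
    fun σ _ => swap_mul_involutive i j σ
  have hM : ∀ k, M (swap i j k) = M k := fun k => by
    rcases eq_or_ne k i with rfl | hki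
    · rw [swap_apply_left, h]
    rcases eq_or_ne k j with rfl | hkj
    · rw [swap_apply_right, h]
    · rw [swap_apply_of_ne_of_ne hki hkj]
  simp only [Perm.mul_apply, hM, Perm.sign_mul, Perm.sign_swap hij, neg_one_mul, Units.neg_smul,
    add_neg_cancel]

theorem columnDet_updateRow (M : Matrix (Fin n) (Fin n) A) (b : Fin n) (r : Fin n → A) :
    columnDet (M.updateRow b r) = ∑ k, columnDet (M.updateCol k (Pi.single b (r k))) := by
  simp only [columnDet]
  rw [Finset.sum_comm]
  refine Finset.sum_congr rfl fun σ _ => ?_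
  rw [Finset.sum_eq_single (σ.symm b), updateCol_perm_apply]
  · congr 3
    funext k
    rcases eq_or_ne k (σ.symm b) with rfl | hk
    · simp
    · rw [Function.update_of_ne hk, updateRow_ne]
      exact fun h => hk (by rw [← h, symm_apply_apply])
  · intro k _ hk
    have hb : σ k ≠ b := fun h => hk (by rw [← h, symm_apply_apply])
    rw [List.prod_eq_zero, smul_zero]
    exact List.mem_ofFn.mpr ⟨k, by simp [hb]⟩
  · simp

theorem lie_columnDet (e : A) (M : Matrix (Fin n) (Fin n) A) :
    ⁅e, columnDet M⁆ = ∑ k, columnDet (M.updateCol k fun i => ⁅e, M i k⁆) := by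
  have hsmul (ε : ℤˣ) (x : A) : ⁅e, ε • x⁆ = ε • ⁅e, x⁆ := by
    simp only [Ring.lie_def, mul_smul_comm, smul_mul_assoc, smul_sub]
  simp only [columnDet, updateCol_perm_apply, lie_sum, hsmul, lie_prod_ofFn, Finset.smul_sum]
  exact Finset.sum_comm

theorem columnDet_eq_sum_zero (M : Matrix (Fin (n + 1)) (Fin (n + 1)) A) :
    columnDet M = ∑ i, M i 0 * columnDet (M.updateCol 0 (Pi.single i 1)) := by
  have key (σ : Perm (Fin (n + 1))) (i : Fin (n + 1)) :
      M i 0 * (List.ofFn fun k => M.updateCol 0 (Pi.single i 1) (σ k) k).prod =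
        if i = σ 0 then (List.ofFn fun k => M (σ k) k).prod else 0 := by
    rw [List.ofFn_succ, List.ofFn_succ]
    rcases eq_or_ne i (σ 0) with rfl | hi
    · simp
    · simp [hi, hi.symm]
  simp only [columnDet, Finset.mul_sum, mul_smul_comm, key]
  rw [Finset.sum_comm]
  simp

theorem columnDet_eq_sum_last (M : Matrix (Fin (n + 1)) (Fin (n + 1)) A) :
    columnDet M =
      ∑ i, columnDet (M.updateCol (Fin.last n) (Pi.single i 1)) * M i (Fin.last n) := by
  have key (σ : Perm (Fin (n + 1))) (i : Fin (n + 1)) :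
      (List.ofFn fun k => M.updateCol (Fin.last n) (Pi.single i 1) (σ k) k).prod *
          M i (Fin.last n) =
        if i = σ (Fin.last n) then (List.ofFn fun k => M (σ k) k).prod else 0 := by
    rw [List.ofFn_succ_last, List.ofFn_succ_last]
    rcases eq_or_ne i (σ (Fin.last n)) with rfl | hi
    · simp
    · simp [hi, hi.symm]
  simp only [columnDet, Finset.sum_mul, smul_mul_assoc, key]
  rw [Finset.sum_comm]
  simp

theorem columnDet_add_columnDet_eq_zero_of_covBy {M N : Matrix (Fin n) (Fin n) A}
    {k l : Fin n} (hkl : k ⋖ l)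
    (hMN : ∀ i m, m ≠ k → m ≠ l → N i m = M i m)
    (hsymm : ∀ a b, M a k * M b l + N a k * N b l = M b k * M a l + N b k * N a l) :
    columnDet M + columnDet N = 0 := by
  simp only [columnDet, ← Finset.sum_add_distrib, ← smul_add]
  refine Finset.sum_involution (fun σ _ => σ * swap k l) (fun σ _ => ?_)
    (fun σ _ _ => mul_swap_eq_iff.not.mpr hkl.lt.ne) (fun _ _ => Finset.mem_univ _)
    fun σ _ => mul_swap_involutive k l σ
  obtain ⟨L, R, hLR⟩ := exists_prod_ofFn_eq_mul_mul hkl fun m => M (σ m) m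
  rw [hLR (fun m => M (σ m) m) fun m _ _ => rfl, hLR (fun m => N (σ m) m) fun m => hMN _ _,
    hLR (fun m => M ((σ * swap k l) m) m), hLR (fun m => N ((σ * swap k l) m) m)]
  · simp only [Perm.mul_apply, swap_apply_left, swap_apply_right, Perm.sign_mul,
      Perm.sign_swap hkl.lt.ne, mul_neg_one, Units.neg_smul, ← mul_add, ← add_mul, hsymm,
      add_neg_cancel]
  · intro m hk hl
    rw [Perm.mul_apply, swap_apply_of_ne_of_ne hk hl, hMN _ _ hk hl]
  · intro m hk hl
    rw [Perm.mul_apply, swap_apply_of_ne_of_ne hk hl]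

theorem columnDet_eq_zero_of_covBy {M : Matrix (Fin n) (Fin n) A} {k l : Fin n} (hkl : k ⋖ l)
    (hsymm : ∀ a b, M a k * M b l = M b k * M a l) : columnDet M = 0 := by
  have h := columnDet_add_columnDet_eq_zero_of_covBy hkl (M := M) (N := M.updateCol k (0 - 0))
    (fun i m hk _ => updateCol_ne hk) (by simpa using hsymm)
  rwa [columnDet_updateCol_sub, sub_self, add_zero] at h

/-- `M` and `N` are exchangeable if their columns, regarded as vectors `Mᵢ = ∑ₐ Mₐᵢ eₐ` in the
exterior algebra over `A`, satisfy `Mᵢ ∧ Nᵢ = 0` and `Mᵢ ∧ Nⱼ = -Mⱼ ∧ Nᵢ`. The first relation is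
required separately because `2` may be a zero divisor in `A`. -/
structure Exchangeable {m : Type*} (M N : Matrix m ι A) : Prop where
  same_col (a b : m) (j : ι) : M a j * N b j = M b j * N a j
  swap_col (a b : m) (i j : ι) :
    M a i * N b j + M a j * N b i = M b i * N a j + M b j * N a i

variable {S : Fin n → Matrix (Fin n) ι A}

theorem columnDet_selectCols_comp_perm
    (hS : ∀ k l, k ⋖ l → Exchangeable (S k) (S l))
    (c : Fin n → ι) (s : Perm (Fin n)) :
    columnDet (selectCols S (c ∘ s)) = Perm.sign s • columnDet (selectCols S c) := by
  cases n with
  | zero => simp [Subsingleton.elim s 1]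
  | succ n =>
  have hs : s ∈ Submonoid.closure (Set.range fun i : Fin n => swap i.castSucc i.succ) := by
    simp [Perm.mclosure_swap_castSucc_succ]
  induction hs using Submonoid.closure_induction_right with
  | one => simp
  | mul_right s _ t ht ih =>
    obtain ⟨i, rfl⟩ := ht
    have hi : i.castSucc ⋖ i.succ := Fin.covBy_iff.mpr (by simp)
    have h := columnDet_add_columnDet_eq_zero_of_covBy hi (M := selectCols S (c ∘ s))
      (N := selectCols S (c ∘ s ∘ swap i.castSucc i.succ))
      (fun a m hm hm' => by simp [selectCols, swap_apply_of_ne_of_ne hm hm'])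
      (fun a b => by simpa [selectCols] using (hS _ _ hi).swap_col a b _ _)
    rw [Perm.coe_mul, eq_neg_of_add_eq_zero_right h, ih, Perm.sign_mul, Perm.sign_swap hi.lt.ne,
      mul_neg_one, Units.neg_smul]

theorem columnDet_selectCols_eq_zero
    (hS : ∀ k l, k ⋖ l → Exchangeable (S k) (S l))
    {c : Fin n → ι} {k l : Fin n} (hkl : k ≠ l) (hc : c k = c l) :
    columnDet (selectCols S c) = 0 := by
  wlog h : k < l generalizing k l
  · exact this hkl.symm hc.symm (hkl.lt_or_gt.resolve_left h)
  obtain ⟨q, hkq, -⟩ := exists_covBy_le_of_lt h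
  have hadj : columnDet (selectCols S (c ∘ swap q l)) = 0 :=
    columnDet_eq_zero_of_covBy hkq fun a b => by
      simpa [selectCols, swap_apply_of_ne_of_ne hkq.lt.ne hkl, hc] using
        (hS k q hkq).same_col a b (c l)
  rwa [columnDet_selectCols_comp_perm hS, smul_eq_zero_iff_eq] at hadj

end ColumnDeterminant

section Cofactors

variable {A : Type*} [Ring A] {n : ℕ}

theorem sign_smul_columnDet_selectCols_update_swap {S : Fin n → Matrix (Fin n) (Fin n) A}
    (hS : ∀ k l, k ⋖ l → Exchangeable (S k) (S l))
    (k l j : Fin n) :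
    Perm.sign (swap k l) • columnDet (selectCols S (Function.update (swap k l) k j)) =
      if j = l then columnDet (selectCols S id) else 0 := by
  split_ifs with hj
  · have hupdate : Function.update (swap k l) k j = id ∘ swap k l := by
      rw [hj, Function.id_comp, Function.update_eq_self_iff, swap_apply_left]
    rw [hupdate, columnDet_selectCols_comp_perm hS, smul_smul, Int.units_mul_self, one_smul]
  · have hk : swap k l j ≠ k := fun h => hj (by simpa using congrArg (swap k l) h)
    rw [columnDet_selectCols_eq_zero hS hk (by simp [hk]), smul_zero]

theorem commute_columnDet_selectCols {S : Fin n → Matrix (Fin n) (Fin n) A}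
    (hS : ∀ k l, k ⋖ l → Exchangeable (S k) (S l))
    {e : A} (a b : Fin n)
    (he : ∀ k i j, ⁅e, S k i j⁆ =
      (if i = b then S k a j else 0) - if j = a then S k i b else 0) :
    Commute e (columnDet (selectCols S id)) := by
  set M := selectCols S id with hM
  have hlie (k : Fin n) : (fun i => ⁅e, M i k⁆) =
      Pi.single b (M a k) - if k = a then fun i => S k i b else 0 := by
    funext i
    simp only [hM, selectCols, of_apply, id, he, Pi.sub_apply, Pi.single_apply]
    split_ifs <;> rfl
  have hcol (k : Fin n) : columnDet (M.updateCol k (if k = a then fun i => S k i b else 0)) =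
      if k = a then columnDet (selectCols S (Function.update id a b)) else 0 := by
    split_ifs with hk
    · rw [hk, selectCols_update]
    · rw [← sub_self (0 : Fin n → A), columnDet_updateCol_sub, sub_self]
  have hdiag := sign_smul_columnDet_selectCols_update_swap hS a a b
  rw [swap_self, Perm.sign_refl, one_smul, coe_refl] at hdiag
  rw [commute_iff_lie_eq, lie_columnDet]
  simp only [hlie, columnDet_updateCol_sub, Finset.sum_sub_distrib, hcol, ← columnDet_updateRow,
    Finset.sum_ite_eq', Finset.mem_univ, if_true, hdiag]
  split_ifs with hab
  · rw [hab, updateRow_eq_self, sub_self]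
  · rw [sub_zero, columnDet_eq_zero_of_row_eq hab]
    rw [updateRow_self, updateRow_ne (Ne.symm hab)]

/-- The matrix of cofactors of `selectCols S id`, where column `l` is moved to position `k` before
it is deleted: the expansion of the determinant then involves the entries of `S k` only. -/
def columnCofactor (S : Fin n → Matrix (Fin n) (Fin n) A) (k : Fin n) : Matrix (Fin n) (Fin n) A :=
  of fun l i =>
    Perm.sign (swap k l) • columnDet ((selectCols S (swap k l)).updateCol k (Pi.single i 1))

theorem transpose_mul_transpose_columnCofactor
    {S : Fin (n + 1) → Matrix (Fin (n + 1)) (Fin (n + 1)) A}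
    (hS : ∀ k l, k ⋖ l → Exchangeable (S k) (S l)) :
    (S 0)ᵀ * (columnCofactor S 0)ᵀ = scalar _ (columnDet (selectCols S id)) := by
  ext j l
  rw [scalar_apply, diagonal_apply, ← sign_smul_columnDet_selectCols_update_swap hS 0 l j,
    columnDet_eq_sum_zero, Finset.smul_sum, mul_apply]
  simp [columnCofactor, selectCols_update]

theorem columnCofactor_mul
    {S : Fin (n + 1) → Matrix (Fin (n + 1)) (Fin (n + 1)) A}
    (hS : ∀ k l, k ⋖ l → Exchangeable (S k) (S l)) :
    columnCofactor S (Fin.last n) * S (Fin.last n) = scalar _ (columnDet (selectCols S id)) := by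
  ext l j
  simp only [scalar_apply, diagonal_apply, eq_comm (a := l)]
  rw [← sign_smul_columnDet_selectCols_update_swap hS (Fin.last n) l j, columnDet_eq_sum_last,
    Finset.smul_sum, mul_apply]
  simp [columnCofactor, selectCols_update]

end Cofactors

section CapelliPolynomial

variable {A : Type*} [Ring A]

theorem commute_scalar_apply {ι : Type*} [DecidableEq ι] [Fintype ι] {w : A}
    (hw : ∀ a, Commute w a) (i j : ι) (a : A) : Commute (scalar ι w i j) a := by
  rw [scalar_apply, diagonal_apply]
  split_ifs
  exacts [hw a, Commute.zero_left a]

/-- The entries of `x` satisfy the commutation relations of the matrix units of `𝔤𝔩`. -/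
def IsGlMatrix {ι : Type*} [DecidableEq ι] (x : Matrix ι ι A) : Prop :=
  ∀ i j k l, ⁅x i j, x k l⁆ = (if k = j then x i l else 0) - if l = i then x k j else 0

namespace IsGlMatrix

variable {ι : Type*} [DecidableEq ι] {x : Matrix ι ι A}

theorem map {B : Type*} [Ring B] (hx : IsGlMatrix x) (f : A →+* B) : IsGlMatrix (x.map f) := by
  intro i j k l
  have h := congrArg f (hx i j k l)
  simpa only [Ring.lie_def, map_sub, map_mul, apply_ite f, map_zero, Matrix.map_apply] using h

theorem lie_add_scalar [Fintype ι] (hx : IsGlMatrix x) {w : A} (hw : ∀ a, Commute w a)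
    (i j k l : ι) :
    ⁅x i j, (x + scalar ι w) k l⁆ =
      (if k = j then (x + scalar ι w) i l else 0) - if l = i then (x + scalar ι w) k j else 0 := by
  rw [Matrix.add_apply x _ k l, lie_add, (commute_scalar_apply hw k l _).symm.lie_eq, hx i j k l]
  simp only [Matrix.add_apply, scalar_apply, diagonal_apply, eq_comm (a := i)]
  split_ifs <;> abel

theorem add_scalar [Fintype ι] (hx : IsGlMatrix x) {w : A} (hw : ∀ a, Commute w a) :
    IsGlMatrix (x + scalar ι w) := by
  intro i j k l
  rw [← hx.lie_add_scalar hw, Matrix.add_apply x _ i j, add_lie,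
    (commute_scalar_apply hw i j _).lie_eq, add_zero]

theorem exchangeable_sub_one (hx : IsGlMatrix x) : Exchangeable x (x - 1) where
  same_col a b j := by
    have h := sub_eq_iff_eq_add.mp (hx a j b j)
    simp only [Matrix.sub_apply, one_apply, mul_sub, mul_ite, mul_one, mul_zero, h,
      eq_comm (a := j)]
    abel
  swap_col a b i j := by
    have h := sub_eq_iff_eq_add.mp (hx a i b j)
    have h' := sub_eq_iff_eq_add.mp (hx a j b i)
    simp only [Matrix.sub_apply, one_apply, mul_sub, mul_ite, mul_one, mul_zero, h, h',
      eq_comm (a := i), eq_comm (a := j)]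
    abel

end IsGlMatrix

variable {ι : Type*} [Fintype ι] [DecidableEq ι]

/-- The matrix `u + x - k`, where `u` is the polynomial variable. -/
def capelliFactor (x : Matrix ι ι A) (k : ℕ) : Matrix ι ι A[X] :=
  scalar ι X + x.map C - (k : Matrix ι ι A[X])

theorem capelliFactor_eq_map_add_scalar (x : Matrix ι ι A) (k : ℕ) :
    capelliFactor x k = x.map C + scalar ι (X - (k : A[X])) := by
  rw [capelliFactor, map_sub, map_natCast]
  abel

theorem exchangeable_capelliFactor {x : Matrix ι ι A} (hx : IsGlMatrix x) (k : ℕ) :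
    Exchangeable (capelliFactor x k) (capelliFactor x (k + 1)) := by
  have hw (p : A[X]) : Commute (X - (k : A[X])) p := (commute_X p).sub_left (Nat.cast_commute k p)
  have h : capelliFactor x (k + 1) = capelliFactor x k - 1 := by
    rw [capelliFactor, capelliFactor, Nat.cast_succ, sub_sub]
  rw [h, capelliFactor_eq_map_add_scalar]
  exact ((hx.map C).add_scalar hw).exchangeable_sub_one

variable {n : ℕ}

/-- The Capelli determinant of `x`, a polynomial in `u`: the column determinant whose `k`-th column
is taken from `u + x - k`. -/
def capelliPolynomial (x : Matrix (Fin n) (Fin n) A) : A[X] :=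
  columnDet (selectCols (fun k : Fin n => capelliFactor x k) id)

variable {x : Matrix (Fin n) (Fin n) A}

theorem exchangeable_capelliFactor_of_covBy (hx : IsGlMatrix x) (k l : Fin n) (hkl : k ⋖ l) :
    Exchangeable (capelliFactor x k) (capelliFactor x l) := by
  rw [← Nat.covBy_iff_add_one_eq.mp (Fin.covBy_iff.mp hkl)]
  exact exchangeable_capelliFactor hx k

theorem commute_coeff_capelliPolynomial (hx : IsGlMatrix x) (k : ℕ) (a b : Fin n) :
    Commute ((capelliPolynomial x).coeff k) (x a b) := by
  have h : Commute (C (x a b)) (capelliPolynomial x) := by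
    refine commute_columnDet_selectCols (exchangeable_capelliFactor_of_covBy hx) a b fun k i j => ?_
    have hw (p : A[X]) : Commute (X - ((k : ℕ) : A[X])) p :=
      (commute_X p).sub_left (Nat.cast_commute (k : ℕ) p)
    simp only [capelliFactor_eq_map_add_scalar]
    exact (hx.map C).lie_add_scalar hw a b i j
  rw [commute_iff_eq]
  simpa only [coeff_C_mul, coeff_mul_C] using congrArg (coeff · k) h.symm.eq

theorem eval₂_capelliPolynomial_neg_add (hx : IsGlMatrix x) :
    (capelliPolynomial x).eval₂ (scalar (Fin n)) (-x + (n : Matrix (Fin n) (Fin n) A) - 1) = 0 := by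
  cases n with
  | zero => exact Subsingleton.elim _ _
  | succ n =>
    have hlast : capelliFactor x (Fin.last n : ℕ) =
        scalar _ X - (-x + ((n + 1 : ℕ) : Matrix _ _ A) - 1).map C := by
      change _ = _ - (C : A →+* A[X]).mapMatrix _
      rw [map_sub, map_add, map_neg, map_natCast, map_one, RingHom.mapMatrix_apply, capelliFactor,
        Fin.val_last, Nat.cast_succ]
      abel
    have hmul : _ * capelliFactor x (Fin.last n : ℕ) = scalar _ (capelliPolynomial x) :=
      columnCofactor_mul (S := fun k => capelliFactor x k)
        (exchangeable_capelliFactor_of_covBy hx)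
    rw [hlast] at hmul
    exact eval₂_scalar_eq_zero_of_mul_eq hmul

theorem eval₂_capelliPolynomial_neg_transpose (hx : IsGlMatrix x) :
    (capelliPolynomial x).eval₂ (scalar (Fin n)) (-xᵀ) = 0 := by
  cases n with
  | zero => exact Subsingleton.elim _ _
  | succ n =>
    have hzero : (capelliFactor x ((0 : Fin (n + 1)) : ℕ))ᵀ = scalar _ X - (-xᵀ).map C := by
      change _ = _ - (C : A →+* A[X]).mapMatrix _
      rw [map_neg, sub_neg_eq_add, RingHom.mapMatrix_apply, capelliFactor, Fin.val_zero,
        Nat.cast_zero, sub_zero, transpose_add, transpose_map, scalar_apply, diagonal_transpose]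
    have hmul : (capelliFactor x ((0 : Fin (n + 1)) : ℕ))ᵀ * _ = scalar _ (capelliPolynomial x) :=
      transpose_mul_transpose_columnCofactor (S := fun k => capelliFactor x k)
        (exchangeable_capelliFactor_of_covBy hx)
    rw [hzero] at hmul
    exact eval₂_scalar_eq_zero_of_eq_mul
      (fun k i j => (commute_coeff_capelliPolynomial hx k j i).neg_right) hmul

end CapelliPolynomial

section TriangularModLeftIdeal

variable {A : Type*} [Ring A] {n : ℕ}

theorem commute_prod_ofFn {d : Fin n → A} (hd : ∀ i a, Commute (d i) a) (a : A) :
    Commute (List.ofFn d).prod a :=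
  Commute.list_prod_left _ _ (List.forall_mem_ofFn_iff.mpr fun i => hd i a)

theorem prod_ofFn_sub_prod_ofFn_mem (I : Ideal A) {f d : Fin n → A}
    (hd : ∀ i a, Commute (d i) a) (hfd : ∀ i, f i - d i ∈ I) :
    (List.ofFn f).prod - (List.ofFn d).prod ∈ I := by
  induction n with
  | zero => simp
  | succ n ih =>
    have htail := ih (fun i => hd i.succ) fun i => hfd i.succ
    have hcomm := commute_prod_ofFn (fun i => hd i.succ) (f 0 - d 0)
    simp only [List.ofFn_succ, List.prod_cons]
    rw [← sub_add_sub_cancel _ (f 0 * (List.ofFn fun i => d i.succ).prod), ← mul_sub, ← sub_mul,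
      ← hcomm.eq]
    exact I.add_mem (I.mul_mem_left _ htail) (I.mul_mem_left _ (hfd 0))

theorem prod_ofFn_mem_of_mem (I : Ideal A) {f d : Fin n → A} (hd : ∀ i a, Commute (d i) a)
    {k : Fin n} (hk : f k ∈ I) (hfd : ∀ i, k < i → f i - d i ∈ I) :
    (List.ofFn f).prod ∈ I := by
  induction n with
  | zero => exact k.elim0
  | succ n ih =>
    rw [List.ofFn_succ, List.prod_cons]
    cases k using Fin.cases with
    | succ k =>
      exact I.mul_mem_left _ (ih (fun i => hd i.succ) hk fun i hi =>
        hfd i.succ (Fin.succ_lt_succ_iff.mpr hi))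
    | zero =>
      have htail := prod_ofFn_sub_prod_ofFn_mem I (fun i => hd i.succ)
        fun i => hfd i.succ i.succ_pos
      have hcomm := commute_prod_ofFn (fun i => hd i.succ) (f 0)
      rw [← sub_add_cancel (List.ofFn fun i => f i.succ).prod, mul_add, ← hcomm.eq]
      exact I.add_mem (I.mul_mem_left _ htail) (I.mul_mem_left _ hk)

theorem exists_perm_apply_lt_of_ne_one {σ : Perm (Fin n)} (hσ : σ ≠ 1) :
    ∃ k, σ k < k ∧ ∀ i, k < i → σ i = i := by
  have hne : σ.support.Nonempty :=
    Finset.nonempty_iff_ne_empty.mpr (Perm.support_eq_empty_iff.not.mpr hσ)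
  have hmem := σ.support.max'_mem hne
  refine ⟨σ.support.max' hne, lt_of_le_of_ne ?_ (Perm.mem_support.mp hmem), fun i hi => ?_⟩
  · exact σ.support.le_max' _ (Perm.apply_mem_support.mpr hmem)
  · by_contra h
    exact (σ.support.le_max' i (Perm.mem_support.mpr h)).not_gt hi

theorem columnDet_sub_prod_mem (I : Ideal A) {M : Matrix (Fin n) (Fin n) A} {d : Fin n → A}
    (hd : ∀ i a, Commute (d i) a) (hlt : ∀ i j, i < j → M i j ∈ I)
    (hdiag : ∀ i, M i i - d i ∈ I) : columnDet M - (List.ofFn d).prod ∈ I := by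
  rw [columnDet, ← Finset.add_sum_erase _ _ (Finset.mem_univ 1), Perm.sign_one, one_smul,
    add_sub_right_comm]
  refine I.add_mem (prod_ofFn_sub_prod_ofFn_mem I hd hdiag) (sum_mem fun σ hσ => ?_)
  obtain ⟨k, hk, hfix⟩ := exists_perm_apply_lt_of_ne_one (Finset.ne_of_mem_erase hσ)
  rw [Units.smul_def]
  refine zsmul_mem (prod_ofFn_mem_of_mem I (f := fun k => M (σ k) k) hd (hlt _ _ hk)
    fun i hi => ?_) _
  rw [hfix i hi]
  exact hdiag i

/-- The left ideal of `A[X]` of the polynomials with coefficients in a left ideal `J` of `A`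
(Mathlib's `Ideal.map C J` has this description only over commutative rings). -/
def coeffIdeal (J : Ideal A) : Ideal A[X] where
  carrier := {P | ∀ k, P.coeff k ∈ J}
  zero_mem' _ := J.zero_mem
  add_mem' hP hQ k := by simpa only [coeff_add] using J.add_mem (hP k) (hQ k)
  smul_mem' Q P hP k := by
    rw [smul_eq_mul, coeff_mul]
    exact sum_mem fun m _ => J.mul_mem_left _ (hP m.2)

theorem C_mem_coeffIdeal {J : Ideal A} {a : A} (ha : a ∈ J) : C a ∈ coeffIdeal J := by
  intro k
  rw [coeff_C]
  split_ifs
  exacts [ha, J.zero_mem]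

theorem commute_C_of_forall_commute {a : A} (ha : ∀ b, Commute a b) (P : A[X]) :
    Commute (C a) P := by
  ext k
  rw [coeff_C_mul, coeff_mul_C, (ha _).eq]

theorem capelliPolynomial_sub_prod_mem_coeffIdeal {J : Ideal A} {x : Matrix (Fin n) (Fin n) A}
    {c : Fin n → A} (hc : ∀ i a, Commute (c i) a) (hlt : ∀ i j, i < j → x i j ∈ J)
    (hdiag : ∀ i, x i i - c i ∈ J) :
    capelliPolynomial x - (List.ofFn fun i : Fin n => X + C (c i - (i : ℕ))).prod ∈
      coeffIdeal J := by
  have hfactor (i j : Fin n) : selectCols (fun k : Fin n => capelliFactor x k) id i j =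
      C (x i j) + if i = j then X - ((j : ℕ) : A[X]) else 0 := by
    rw [selectCols, of_apply, capelliFactor_eq_map_add_scalar, Matrix.add_apply, Matrix.map_apply,
      scalar_apply, diagonal_apply, id]
  refine columnDet_sub_prod_mem _ (fun i P => ?_) (fun i j hij => ?_) fun i => ?_
  · exact (commute_X P).add_left
      (commute_C_of_forall_commute (fun b => (hc i b).sub_left (Nat.cast_commute _ b)) P)
  · rw [hfactor, if_neg hij.ne, add_zero]
    exact C_mem_coeffIdeal (hlt i j hij)
  · convert C_mem_coeffIdeal (hdiag i) using 1
    rw [hfactor, if_pos rfl, C_sub, C_sub, map_natCast]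
    abel

end TriangularModLeftIdeal

section EnvelopingAlgebra

open UniversalEnvelopingAlgebra

variable {K L : Type*} [CommRing K] [LieRing L] [LieAlgebra K L]

theorem mem_center_of_commute_ι {z : UniversalEnvelopingAlgebra K L}
    (hz : ∀ x, Commute (ι K x) z) : z ∈ Subalgebra.center K (UniversalEnvelopingAlgebra K L) := by
  let S := Subalgebra.centralizer K {z}
  have hι (x : L) : ι K x ∈ S := by
    simpa only [S, Subalgebra.mem_centralizer_iff, Set.mem_singleton_iff, forall_eq] using
      (hz x).symm.eq
  let ιS : L →ₗ⁅K⁆ S :=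
    { toFun := fun x => ⟨ι K x, hι x⟩
      map_add' := fun x y => Subtype.ext (map_add (ι K) x y)
      map_smul' := fun a x => Subtype.ext (map_smul (ι K) a x)
      map_lie' := fun {x y} => Subtype.ext (LieHom.map_lie (ι K) x y) }
  have hS : S.val.comp (lift K ιS) = AlgHom.id K _ := by
    ext x
    exact congrArg S.val (lift_ι_apply K ιS x)
  refine Subalgebra.mem_center_iff.mpr fun y => ?_
  have hy : (lift K ιS y : UniversalEnvelopingAlgebra K L) = y := DFunLike.congr_fun hS y
  exact hy ▸ (Subalgebra.mem_centralizer_iff K).mp (lift K ιS y).2 z rfl |>.symm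

theorem lift_toEnd_eq_algebraMap_of_mem_center {V : Type*} [AddCommGroup V] [Module K V]
    [LieRingModule L V] [LieModule K L V] {z : UniversalEnvelopingAlgebra K L}
    (hz : z ∈ Subalgebra.center K (UniversalEnvelopingAlgebra K L)) {v : V} {c : K}
    (hv : LieSubmodule.lieSpan K L {v} = ⊤) (hzv : lift K (LieModule.toEnd K L V) z v = c • v) :
    lift K (LieModule.toEnd K L V) z = algebraMap K _ c := by
  set ρ := lift K (LieModule.toEnd K L V)
  let N : LieSubmodule K L V :=
    { LinearMap.eqLocus (ρ z) (algebraMap K (Module.End K V) c) with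
      lie_mem := fun {x w} (hw : ρ z w = c • w) => by
        have hx : ρ z ⁅x, w⁆ = ⁅x, ρ z w⁆ := by
          simpa [ρ, lift_ι_apply] using
            (congrArg (ρ · w) (Subalgebra.mem_center_iff.mp hz (ι K x))).symm
        change ρ z ⁅x, w⁆ = c • ⁅x, w⁆
        rw [hx, hw, lie_smul] }
  have hN : N = ⊤ := by
    rw [eq_top_iff, ← hv, LieSubmodule.lieSpan_le, Set.singleton_subset_iff]
    exact hzv
  ext w
  have hw : w ∈ N := hN ▸ LieSubmodule.mem_top w
  exact hw

theorem prod_ofFn_neg_sub_algebraMap_eq_zero {A B ι : Type*} [Ring A] [Ring B] [Algebra K B]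
    [Fintype ι] [DecidableEq ι] {n : ℕ} (ρ : A →+* B) {P : A[X]} {l : Fin n → K}
    (hP : P.map ρ = (∏ i, (X + C (l i))).map (algebraMap K B)) {M : Matrix ι ι A}
    (hM : P.eval₂ (scalar ι) M = 0) :
    (List.ofFn fun i => -M.map ρ - algebraMap K (Matrix ι ι B) (l i)).prod = 0 := by
  have haeval : aeval (M.map ρ) (∏ i, (X + C (l i))) = 0 := by
    have hscalar : ρ.mapMatrix.comp (scalar ι) = (scalar ι).comp ρ := by
      ext a : 1
      exact diagonal_map (map_zero ρ)
    have halgebraMap : (scalar ι).comp (algebraMap K B) = algebraMap K (Matrix ι ι B) := rfl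
    rw [aeval_def, ← halgebraMap, ← eval₂_map, ← hP, eval₂_map, ← hscalar,
      ← RingHom.mapMatrix_apply, ← hom_eval₂, hM, map_zero]
  have hneg : (fun i => -M.map ρ - algebraMap K (Matrix ι ι B) (l i)) =
      Neg.neg ∘ aeval (M.map ρ) ∘ fun i => X + C (l i) := by
    funext i
    simp only [Function.comp_apply, map_add, aeval_X, aeval_C]
    abel
  rw [hneg, ← List.map_ofFn, List.prod_map_neg, ← List.map_ofFn, ← map_list_prod, List.prod_ofFn,
    haeval, mul_zero]

end EnvelopingAlgebra

section GlGenerators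

open UniversalEnvelopingAlgebra

variable (K : Type*) [CommRing K] (n : ℕ)

/-- The matrix `E` whose `(i, j)` entry is the matrix unit `E_ij`, seen in the universal enveloping
algebra of `𝔤𝔩ₙ(K)`. -/
def glGenerators :
    Matrix (Fin n) (Fin n) (UniversalEnvelopingAlgebra K (Matrix (Fin n) (Fin n) K)) :=
  of fun i j => ι K (single i j (1 : K))

theorem isGlMatrix_glGenerators : IsGlMatrix (glGenerators K n) := by
  have hmul (i j k l : Fin n) : ι K (single i j (1 : K) * single k l 1) =
      if k = j then glGenerators K n i l else 0 := by
    split_ifs with h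
    · rw [h, single_mul_single_same, mul_one, glGenerators, of_apply]
    · rw [single_mul_single_of_ne _ _ _ _ (Ne.symm h), map_zero]
  intro i j k l
  simp only [eq_comm (a := l)]
  rw [← hmul i j k l, ← hmul k l i j, ← map_sub]
  exact ((ι K).map_lie (single i j (1 : K)) (single k l (1 : K))).symm

theorem coeff_capelliPolynomial_glGenerators_mem_center (k : ℕ) :
    (capelliPolynomial (glGenerators K n)).coeff k ∈
      Subalgebra.center K (UniversalEnvelopingAlgebra K (Matrix (Fin n) (Fin n) K)) := by
  refine mem_center_of_commute_ι fun x => ?_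
  have hx : ι K x = ∑ i, ∑ j, x i j • glGenerators K n i j := by
    conv_lhs => rw [matrix_eq_sum_single x]
    simp only [map_sum, glGenerators, of_apply, ← map_smul, smul_single, smul_eq_mul, mul_one]
  rw [hx]
  exact Commute.sum_left _ _ _ fun i _ => Commute.sum_left _ _ _ fun j _ =>
    ((commute_coeff_capelliPolynomial (isGlMatrix_glGenerators K n) k i j).smul_right _).symm

variable {K n} {V : Type*} [AddCommGroup V] [Module K V]
  [LieRingModule (Matrix (Fin n) (Fin n) K) V] [LieModule K (Matrix (Fin n) (Fin n) K) V]

theorem map_prod_X_add_C (A : Type*) [Ring A] [Algebra K A] (c : Fin n → K) :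
    (∏ i, (X + C (c i))).map (algebraMap K A) =
      (List.ofFn fun i => X + C (algebraMap K A (c i))).prod := by
  rw [← List.prod_ofFn, ← coe_mapRingHom, map_list_prod, List.map_ofFn]
  simp only [Function.comp_def, coe_mapRingHom, Polynomial.map_add, map_X, map_C]

theorem map_capelliPolynomial_glGenerators {lam : Fin n → K} {v : V}
    (hlt : ∀ i j : Fin n, i < j → ⁅single i j (1 : K), v⁆ = 0)
    (hdiag : ∀ i : Fin n, ⁅single i i (1 : K), v⁆ = lam i • v)
    (hv : LieSubmodule.lieSpan K (Matrix (Fin n) (Fin n) K) {v} = ⊤) :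
    (capelliPolynomial (glGenerators K n)).map
        (lift K (LieModule.toEnd K (Matrix (Fin n) (Fin n) K) V)).toRingHom =
      (∏ i : Fin n, (X + C (lam i - ((i : ℕ) + 1 : K) + 1))).map
        (algebraMap K (Module.End K V)) := by
  set ρ := lift K (LieModule.toEnd K (Matrix (Fin n) (Fin n) K) V)
  have hρ (i j : Fin n) : ρ (glGenerators K n i j) v = ⁅single i j (1 : K), v⁆ := by
    rw [glGenerators, of_apply, lift_ι_apply, LieModule.toEnd_apply_apply]
  let J := (Ideal.torsionOf (Module.End K V) V v).comap ρ
  have hJ {a} : a ∈ J ↔ ρ a v = 0 := Iff.rfl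
  have hmem : capelliPolynomial (glGenerators K n) -
      (∏ i : Fin n, (X + C (lam i - ((i : ℕ) + 1 : K) + 1))).map (algebraMap K _) ∈
        coeffIdeal J := by
    rw [map_prod_X_add_C]
    convert capelliPolynomial_sub_prod_mem_coeffIdeal (fun i a => Algebra.commutes (lam i) a)
      (fun i j hij => ?_) (fun i => ?_) using 6
    · rw [sub_add_eq_sub_sub, sub_add_cancel, map_sub, map_natCast]
    · rw [hJ, hρ, hlt i j hij]
    · simp [hJ, hρ, hdiag]
  ext1 k
  rw [coeff_map, coeff_map]
  refine lift_toEnd_eq_algebraMap_of_mem_center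
    (coeff_capelliPolynomial_glGenerators_mem_center K n k) hv ?_
  have hk := hmem k
  rw [coeff_sub, coeff_map, hJ, map_sub, ρ.commutes] at hk
  exact sub_eq_zero.mp hk

end GlGenerators

theorem capelliDet_eq_capelliPolynomial (n : ℕ) :
    capelliDet n = capelliPolynomial (glGenerators ℂ n) := by
  simp only [capelliPolynomial, columnDet, Units.smul_def, zsmul_eq_mul]
  rfl

end CapelliCH

end

open CapelliCH in
theorem mainTheorem12_general (K : Type*) [CommRing K] (n : ℕ) :
    (∀ k : ℕ, (capelliPolynomial (glGenerators K n)).coeff k ∈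
      Subalgebra.center K (UniversalEnvelopingAlgebra K (Matrix (Fin n) (Fin n) K))) ∧
    (capelliPolynomial (glGenerators K n)).eval₂ (scalar (Fin n)) (-glGenerators K n + n - 1) = 0 ∧
    (capelliPolynomial (glGenerators K n)).eval₂ (scalar (Fin n)) (-(glGenerators K n)ᵀ) = 0 ∧
    ∀ (V : Type*) [AddCommGroup V] [Module K V] [LieRingModule (Matrix (Fin n) (Fin n) K) V]
      [LieModule K (Matrix (Fin n) (Fin n) K) V] (lam : Fin n → K) (v : V),
      (∀ i j : Fin n, i < j → ⁅single i j (1 : K), v⁆ = 0) →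
      (∀ i : Fin n, ⁅single i i (1 : K), v⁆ = lam i • v) →
      LieSubmodule.lieSpan K (Matrix (Fin n) (Fin n) K) {v} = ⊤ →
      (List.ofFn fun i : Fin n =>
        (glGenerators K n).map (UniversalEnvelopingAlgebra.lift K (LieModule.toEnd K _ V))
          - algebraMap K (Matrix (Fin n) (Fin n) (Module.End K V)) (lam i - ((i : ℕ) + 1 : K) + 1)
          - (n : Matrix (Fin n) (Fin n) (Module.End K V)) + 1).prod = 0 ∧
      (List.ofFn fun i : Fin n =>
        ((glGenerators K n).map (UniversalEnvelopingAlgebra.lift K (LieModule.toEnd K _ V)))ᵀ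
          - algebraMap K (Matrix (Fin n) (Fin n) (Module.End K V))
              (lam i - ((i : ℕ) + 1 : K) + 1)).prod = 0 := by
  have hE := isGlMatrix_glGenerators K n
  refine ⟨coeff_capelliPolynomial_glGenerators_mem_center K n, eval₂_capelliPolynomial_neg_add hE,
    eval₂_capelliPolynomial_neg_transpose hE, fun V _ _ _ _ lam v hlt hdiag hv => ?_⟩
  set ρ := UniversalEnvelopingAlgebra.lift K (LieModule.toEnd K (Matrix (Fin n) (Fin n) K) V)
  have hmap := map_capelliPolynomial_glGenerators hlt hdiag hv
  have hadd := prod_ofFn_neg_sub_algebraMap_eq_zero _ hmap (eval₂_capelliPolynomial_neg_add hE)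
  have htranspose := prod_ofFn_neg_sub_algebraMap_eq_zero _ hmap
    (eval₂_capelliPolynomial_neg_transpose hE)
  rw [← RingHom.mapMatrix_apply, map_sub, map_add, map_neg, map_natCast, map_one] at hadd
  rw [← RingHom.mapMatrix_apply, map_neg] at htranspose
  constructor
  · convert hadd using 4 with i
    change _ = -(-(glGenerators K n).map ρ + _ - 1) - _
    abel
  · convert htranspose using 4 with i
    rw [neg_neg]
    rfl

theorem mainTheorem12 (n : ℕ) :
    (∀ k : ℕ, (CapelliCH.capelliDet n).coeff k ∈
      Subalgebra.center ℂ (CapelliCH.U n)) ∧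
    CapelliCH.evalMatrix (CapelliCH.capelliDet n)
      (-CapelliCH.genMatrix n + (n : Matrix (Fin n) (Fin n) (CapelliCH.U n)) - 1) = 0 ∧
    CapelliCH.evalMatrix (CapelliCH.capelliDet n) (-(CapelliCH.genMatrix n)ᵀ) = 0 ∧
    ∀ (V : Type*) [AddCommGroup V] [Module ℂ V] [LieRingModule (CapelliCH.gl n) V]
      [LieModule ℂ (CapelliCH.gl n) V] (lam : Fin n → ℂ),
      CapelliCH.IsHighestWeightRep V lam →
      (List.ofFn fun i : Fin n =>
        CapelliCH.genMatrixOn V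
          - algebraMap ℂ (Matrix (Fin n) (Fin n) (Module.End ℂ V)) (CapelliCH.shiftedWeight lam i)
          - (n : Matrix (Fin n) (Fin n) (Module.End ℂ V)) + 1).prod = 0 ∧
      (List.ofFn fun i : Fin n =>
        (CapelliCH.genMatrixOn V)ᵀ
          - algebraMap ℂ (Matrix (Fin n) (Fin n) (Module.End ℂ V))
              (CapelliCH.shiftedWeight lam i)).prod = 0 := by
  rw [CapelliCH.capelliDet_eq_capelliPolynomial]
  obtain ⟨hcenter, hadd, htranspose, hweight⟩ := mainTheorem12_general ℂ n
  exact ⟨hcenter, hadd, htranspose, fun V _ _ _ _ lam ⟨v, _, hlt, hdiag, hv⟩ =>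
    hweight V lam v hlt hdiag hv⟩
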